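/- Let $0<\gamma<\pi^2/2$. Then there exist constants $\varepsilon=\varepsilon(\gamma)>0$ and $m_0=m_0(\gamma)\in\mathbb N$, depending only on $\gamma$, such that the following holds. For every real or complex Hilbert space $H$, every contraction $S$ on $H$ (that is, every bounded linear operator $S:H\to H$ with $\|S\|\le 1$), and every integer $m\ge m_0$, \[ \|S^m\|\le\varepsilon \quad\Longrightarrow\quad w(S)\le 1-\frac{\gamma}{m^2}, \] where $w(S)=\sup_{\|u\|=1}|\langle Su,u\rangle|$ is the numerical radius of $S$ (with $w(S)=0$ if $H=\{0\}$). -/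

import Mathlib

/-- The numerical radius `w(S) = sup_{‖u‖ = 1} |⟨S u, u⟩|` of a bounded operator `S` on a real or
complex inner product space. The supremum is over a bounded set of nonnegative reals
(`bddAbove_numericalRadius`); it is `0` on the zero space, which has no unit vectors. -/
noncomputable def numericalRadius {𝕜 H : Type*} [RCLike 𝕜] [NormedAddCommGroup H]
    [InnerProductSpace 𝕜 H] (S : H →L[𝕜] H) : ℝ :=
  ⨆ u : {u : H // ‖u‖ = 1}, ‖inner 𝕜 (S u) (u : H)‖

theorem bddAbove_numericalRadius {𝕜 H : Type*} [RCLike 𝕜] [NormedAddCommGroup H]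
    [InnerProductSpace 𝕜 H] (S : H →L[𝕜] H) :
    BddAbove (Set.range fun u : {u : H // ‖u‖ = 1} => ‖inner 𝕜 (S u) (u : H)‖) := by
  refine ⟨‖S‖, ?_⟩
  rintro _ ⟨u, rfl⟩
  have h1 := norm_inner_le_norm (𝕜 := 𝕜) (S u) (u : H)
  have h2 := S.le_opNorm u
  rw [u.2, mul_one] at h1 h2
  exact h1.trans h2

/-! After a unimodular rotation of `S`, it suffices to bound `b 1`, where `b n = Re ⟨Sⁿu, u⟩`. This
sequence is positive definite with `b 0 = 1`, and `|b n| ≤ ε` for `n ≥ m`. By duality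
(`IsPosDefSeq.le_of_nonneg`), a nonnegative `A' - cos θ + T θ`, with `T` of frequencies `≥ m` and
coefficient sum `C`, gives `b 1 ≤ A' + C ε`.

Take `A = cos a` with `a` near `π / m`, and replace `A - cos θ` by its product with `1 + (k - 1) ψ`.
Here `k` is a Fejér kernel in `M θ - π`, small where `A - cos θ < 0`, and `ψ` is a Fejér bump of
degree below `l = M - m`. Since `k - 1` has only frequencies that are nonzero multiples of `M`, the
correction has frequencies `≥ m`. The remaining negativity is a small multiple of `1 - A`, and `C =
O(1 / m²)`, so one `ε` serves all `m` (`fejerCorrection_nonneg`, `highFreq_fejerCorrection`). -/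

/-! ### Positive definite sequences from contractions -/

/-- The Toeplitz kernel `(⟨S^|j-k| u, u⟩)` of a contraction is positive semidefinite. -/
theorem norm_sq_sum_pow_le {𝕜 H : Type*} [RCLike 𝕜] [NormedAddCommGroup H]
    [InnerProductSpace 𝕜 H] (S : H →L[𝕜] H) (hS : ‖S‖ ≤ 1) (u : H) (h : ℕ → ℝ) (N : ℕ) :
    ‖∑ j ∈ Finset.range N, (h j : 𝕜) • (S ^ (N - 1 - j)) u‖ ^ 2 ≤
      ∑ j ∈ Finset.range N, ∑ k ∈ Finset.range N,
        h j * h k * RCLike.re (inner 𝕜 ((S ^ ((j - k) + (k - j))) u) u) := by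
  induction N with
  | zero => simp
  | succ N ih =>
    -- Horner's scheme: the next vector is `S v + h N • u`. Its square expands into the new row and
    -- column of the form; the only loss is `‖S v‖ ≤ ‖v‖`.
    set v := ∑ j ∈ Finset.range N, (h j : 𝕜) • (S ^ (N - 1 - j)) u with hv
    have hSv : S v = ∑ j ∈ Finset.range N, (h j : 𝕜) • (S ^ (N - j)) u := by
      rw [hv, map_sum]
      refine Finset.sum_congr rfl fun j hj => ?_
      have hj' := Finset.mem_range.1 hj
      rw [map_smul, show N - j = (N - 1 - j) + 1 by omega, pow_succ']
      rfl
    have hstep : ∑ j ∈ Finset.range (N + 1), (h j : 𝕜) • (S ^ (N + 1 - 1 - j)) u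
        = S v + (h N : 𝕜) • u := by
      rw [Finset.sum_range_succ, hSv]
      simp
    have hin : RCLike.re (inner 𝕜 (S v) u) = ∑ j ∈ Finset.range N,
        h j * RCLike.re (inner 𝕜 ((S ^ (N - j)) u) u) := by
      rw [hSv, sum_inner, map_sum]
      refine Finset.sum_congr rfl fun j _ => ?_
      rw [inner_smul_left, RCLike.conj_ofReal, RCLike.re_ofReal_mul]
    have hn : ‖S v + (h N : 𝕜) • u‖ ^ 2 = ‖S v‖ ^ 2
        + 2 * (h N * RCLike.re (inner 𝕜 (S v) u)) + h N ^ 2 * ‖u‖ ^ 2 := by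
      rw [norm_add_sq (𝕜 := 𝕜), inner_smul_right, RCLike.re_ofReal_mul, norm_smul,
        RCLike.norm_ofReal, mul_pow, sq_abs]
    have hle : ‖S v‖ ^ 2 ≤ ‖v‖ ^ 2 := by
      have := S.le_of_opNorm_le hS v
      rw [one_mul] at this
      gcongr
    have hdiag : RCLike.re (inner 𝕜 u u) = ‖u‖ ^ 2 := inner_self_eq_norm_sq u
    have h1 : ∑ j ∈ Finset.range N, h j * h N *
        RCLike.re (inner 𝕜 ((S ^ ((j - N) + (N - j))) u) u)
        = h N * RCLike.re (inner 𝕜 (S v) u) := by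
      rw [hin, Finset.mul_sum]
      refine Finset.sum_congr rfl fun j hj => ?_
      rw [show j - N + (N - j) = N - j by have := Finset.mem_range.1 hj; omega]
      ring
    have h2 : ∑ j ∈ Finset.range N, h N * h j *
        RCLike.re (inner 𝕜 ((S ^ ((N - j) + (j - N))) u) u)
        = h N * RCLike.re (inner 𝕜 (S v) u) := by
      rw [← h1]
      refine Finset.sum_congr rfl fun j _ => ?_
      rw [add_comm (N - j), mul_comm (h N)]
    rw [hstep, hn, Finset.sum_range_succ]
    simp_rw [Finset.sum_range_succ]
    rw [Finset.sum_add_distrib, h1, h2]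
    simp only [Nat.sub_self, add_zero, pow_zero, one_apply_eq_self, hdiag]
    linarith

/-- Positive definiteness of a real sequence, tested against real vectors. -/
def IsPosDefSeq (b : ℕ → ℝ) : Prop :=
  ∀ (h : ℕ → ℝ) (N : ℕ),
    0 ≤ ∑ j ∈ Finset.range N, ∑ k ∈ Finset.range N, h j * h k * b ((j - k) + (k - j))

theorem isPosDefSeq_re_inner_pow {𝕜 H : Type*} [RCLike 𝕜] [NormedAddCommGroup H]
    [InnerProductSpace 𝕜 H] (S : H →L[𝕜] H) (hS : ‖S‖ ≤ 1) (u : H) :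
    IsPosDefSeq fun n => RCLike.re (inner 𝕜 ((S ^ n) u) u) :=
  fun h N => (sq_nonneg _).trans (norm_sq_sum_pow_le S hS u h N)

/-! ### Fejér means and exact quadrature -/

/-- The unnormalized Fejér mean of the cosine series with coefficients `b`. -/
noncomputable def fejerMean (b : ℕ → ℝ) (N : ℕ) (θ : ℝ) : ℝ :=
  ∑ j ∈ Finset.range N, ∑ k ∈ Finset.range N,
    b ((j - k) + (k - j)) * Real.cos (((j : ℝ) - k) * θ)

theorem fejerMean_nonneg {b : ℕ → ℝ} (hb : IsPosDefSeq b) (N : ℕ) (θ : ℝ) :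
    0 ≤ fejerMean b N θ := by
  have h1 := hb (fun j => Real.cos (j * θ)) N
  have h2 := hb (fun j => Real.sin (j * θ)) N
  rw [fejerMean]
  simp_rw [sub_mul, Real.cos_sub, mul_add, Finset.sum_add_distrib]
  refine add_nonneg (h1.trans_eq ?_) (h2.trans_eq ?_) <;>
  exact Finset.sum_congr rfl fun j _ => Finset.sum_congr rfl fun k _ => mul_comm _ _

theorem sum_cos_equidistributed {L : ℕ} {x : ℤ} (hx : x ≠ 0) (hxL : |x| < L) :
    ∑ r ∈ Finset.range L, Real.cos (x * (2 * Real.pi * r / L)) = 0 := by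
  have hL : (0 : ℝ) < L := by
    have : (0 : ℤ) < L := (abs_nonneg x).trans_lt hxL
    exact_mod_cast this
  have hs : Real.sin (Real.pi * x / L) ≠ 0 := by
    rw [Real.sin_ne_zero_iff]
    intro n hn
    have h1 : (n : ℝ) * L = x := by
      field_simp at hn
      have := Real.pi_pos
      nlinarith
    have h2 : n * L = x := by exact_mod_cast h1
    have h3 : n ≠ 0 := by rintro rfl; simp at h2; exact hx h2.symm
    have h4 : 1 ≤ |n| := Int.one_le_abs h3
    rw [← h2, abs_mul, Nat.abs_cast] at hxL
    have : (0 : ℤ) < L := by exact_mod_cast hL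
    nlinarith
  -- Multiplying by twice the sine of the half step makes the sum telescope.
  have key : ∀ n : ℕ, 2 * Real.sin (Real.pi * x / L) *
      ∑ r ∈ Finset.range n, Real.cos (x * (2 * Real.pi * r / L))
      = Real.sin ((2 * n - 1) * (Real.pi * x / L)) + Real.sin (Real.pi * x / L) := by
    intro n
    induction n with
    | zero => simp
    | succ n ih =>
      rw [Finset.sum_range_succ, mul_add, ih, Real.two_mul_sin_mul_cos]
      rw [show Real.pi * x / L - x * (2 * Real.pi * n / L)
        = -((2 * n - 1) * (Real.pi * x / L)) by ring, Real.sin_neg,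
        show Real.pi * x / L + x * (2 * Real.pi * n / L)
        = (2 * ((n + 1 : ℕ) : ℝ) - 1) * (Real.pi * x / L) by push_cast; ring]
      ring
  have h := key L
  rw [show (2 * (L : ℝ) - 1) * (Real.pi * x / L)
    = -(Real.pi * x / L) + x * (2 * Real.pi) by field_simp; ring,
    Real.sin_add_int_mul_two_pi, Real.sin_neg, neg_add_cancel] at h
  exact (mul_eq_zero.1 h).resolve_left (mul_ne_zero two_ne_zero hs)

theorem sum_cos_equidistributed_eq_ite {L : ℕ} {x : ℤ} (hxL : |x| < L) :
    ∑ r ∈ Finset.range L, Real.cos (x * (2 * Real.pi * r / L)) = if x = 0 then (L : ℝ) else 0 := by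
  split_ifs with h
  · simp [h]
  · exact sum_cos_equidistributed h hxL

/-- Integration against the Fejér mean of `b`, discretized at the `2N`-th roots of unity. -/
noncomputable def fejerFunctional (b : ℕ → ℝ) (N : ℕ) : (ℝ → ℝ) →ₗ[ℝ] ℝ :=
  (1 / ((2 * N : ℕ) * (N : ℝ))) • ∑ r ∈ Finset.range (2 * N),
    fejerMean b N (2 * Real.pi * r / (2 * N : ℕ)) • LinearMap.proj (2 * Real.pi * r / (2 * N : ℕ))

theorem fejerFunctional_apply (b : ℕ → ℝ) (N : ℕ) (f : ℝ → ℝ) :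
    fejerFunctional b N f = (1 / ((2 * N : ℕ) * (N : ℝ))) * ∑ r ∈ Finset.range (2 * N),
      fejerMean b N (2 * Real.pi * r / (2 * N : ℕ)) * f (2 * Real.pi * r / (2 * N : ℕ)) := by
  simp [fejerFunctional, LinearMap.sum_apply]

theorem fejerFunctional_nonneg {b : ℕ → ℝ} (hb : IsPosDefSeq b) (N : ℕ) {f : ℝ → ℝ}
    (hf : ∀ θ, 0 ≤ f θ) : 0 ≤ fejerFunctional b N f := by
  rw [fejerFunctional_apply]
  exact mul_nonneg (by positivity)
    (Finset.sum_nonneg fun r _ => mul_nonneg (fejerMean_nonneg hb _ _) (hf _))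

/-- The frequencies `j - k ± n` are below `2N` in absolute value, so quadrature at `2N` nodes is
exact; each diagonal `j - k = ±n` has `N - n` entries. -/
theorem fejerFunctional_cos (b : ℕ → ℝ) {N n : ℕ} (hn : n < N) :
    fejerFunctional b N (fun θ => Real.cos (n * θ)) = (N - n) / N * b n := by
  have hN : (N : ℝ) ≠ 0 := by have : 0 < N := by omega
                              positivity
  rw [fejerFunctional_apply]
  have hprod : ∀ j ∈ Finset.range N, ∀ k ∈ Finset.range N,
      ∑ r ∈ Finset.range (2 * N), Real.cos (((j : ℝ) - k) * (2 * Real.pi * r / (2 * N : ℕ))) *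
        Real.cos (n * (2 * Real.pi * r / (2 * N : ℕ)))
      = (if k = j + n then (N : ℝ) else 0) + (if j = k + n then (N : ℝ) else 0) := by
    intro j hj k hk
    rw [Finset.mem_range] at hj hk
    have h1 := sum_cos_equidistributed_eq_ite (L := 2 * N) (x := (j : ℤ) - k + n)
      (by rw [abs_lt]; push_cast; constructor <;> omega)
    have h2 := sum_cos_equidistributed_eq_ite (L := 2 * N) (x := (j : ℤ) - k - n)
      (by rw [abs_lt]; push_cast; constructor <;> omega)
    have e1 : ((j : ℤ) - k + n = 0) ↔ k = j + n := by omega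
    have e2 : ((j : ℤ) - k - n = 0) ↔ j = k + n := by omega
    rw [if_congr e1 rfl rfl] at h1
    rw [if_congr e2 rfl rfl] at h2
    have h3 : ∀ r : ℕ, Real.cos (((j : ℝ) - k) * (2 * Real.pi * r / (2 * N : ℕ))) *
        Real.cos (n * (2 * Real.pi * r / (2 * N : ℕ)))
        = 1 / 2 * (Real.cos (((j : ℤ) - k + n : ℤ) * (2 * Real.pi * r / (2 * N : ℕ))) +
          Real.cos (((j : ℤ) - k - n : ℤ) * (2 * Real.pi * r / (2 * N : ℕ)))) := by
      intro r
      push_cast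
      rw [add_mul, sub_mul _ (n : ℝ), Real.cos_add, Real.cos_sub]
      ring
    simp_rw [h3]
    rw [← Finset.mul_sum, Finset.sum_add_distrib, h1, h2]
    push_cast
    split_ifs <;> ring
  have hcount : ∑ j ∈ Finset.range N, (if j + n < N then (1 : ℝ) else 0) = N - n := by
    rw [← Finset.sum_filter, Finset.sum_const, nsmul_eq_mul, mul_one,
      show (Finset.range N).filter (fun j => j + n < N) = Finset.range (N - n) by
        ext j; simp only [Finset.mem_filter, Finset.mem_range]; omega,
      Finset.card_range, Nat.cast_sub hn.le]
  have hmain : ∑ r ∈ Finset.range (2 * N), fejerMean b N (2 * Real.pi * r / (2 * N : ℕ)) *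
      Real.cos (n * (2 * Real.pi * r / (2 * N : ℕ))) = 2 * N * ((N - n) * b n) := by
    simp only [fejerMean, Finset.sum_mul]
    rw [Finset.sum_comm]
    have hswap : ∀ j ∈ Finset.range N, ∑ r ∈ Finset.range (2 * N), ∑ k ∈ Finset.range N,
        b ((j - k) + (k - j)) * Real.cos (((j : ℝ) - k) * (2 * Real.pi * r / (2 * N : ℕ))) *
          Real.cos (n * (2 * Real.pi * r / (2 * N : ℕ)))
        = ∑ k ∈ Finset.range N, (if k = j + n then (N : ℝ) * b n else 0)
          + ∑ k ∈ Finset.range N, (if j = k + n then (N : ℝ) * b n else 0) := by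
      intro j hj
      rw [Finset.sum_comm, ← Finset.sum_add_distrib]
      refine Finset.sum_congr rfl fun k hk => ?_
      simp_rw [mul_assoc (b _)]
      rw [← Finset.mul_sum, hprod j hj k hk, mul_add]
      congr 1
      · split_ifs with h
        · rw [show j - k + (k - j) = n by omega, mul_comm]
        · rw [mul_zero]
      · split_ifs with h
        · rw [show j - k + (k - j) = n by omega, mul_comm]
        · rw [mul_zero]
    rw [Finset.sum_congr rfl hswap, Finset.sum_add_distrib]
    have h1 : ∀ x : ℝ, ∑ j ∈ Finset.range N, ∑ k ∈ Finset.range N,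
        (if k = j + n then x else 0) = (N - n) * x := by
      intro x
      rw [← hcount, Finset.sum_mul]
      refine Finset.sum_congr rfl fun j _ => ?_
      simp
    rw [h1, Finset.sum_comm, h1]
    ring
  rw [hmain]
  push_cast
  field_simp

/-! ### High-frequency cosine sums and duality -/

/-- `HighFreq m C f`: `f` is a combination of cosines of frequencies at least `m`, with
coefficients of absolute sum at most `C`. -/
inductive HighFreq (m : ℕ) : ℝ → (ℝ → ℝ) → Prop
  | cos (n : ℕ) (hn : m ≤ n) : HighFreq m 1 fun θ => Real.cos (n * θ)
  | add {C D : ℝ} {f g : ℝ → ℝ} (hf : HighFreq m C f) (hg : HighFreq m D g) :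
      HighFreq m (C + D) (f + g)
  | smul {C : ℝ} {f : ℝ → ℝ} (c : ℝ) (hf : HighFreq m C f) : HighFreq m (|c| * C) (c • f)
  | mono {C D : ℝ} {f : ℝ → ℝ} (hf : HighFreq m C f) (h : C ≤ D) : HighFreq m D f

namespace HighFreq

variable {m : ℕ}

theorem zero : HighFreq m 0 0 := by
  simpa using (HighFreq.cos (m := m) m le_rfl).smul 0

theorem sum {ι : Type} (s : Finset ι) (C : ι → ℝ) (f : ι → ℝ → ℝ)
    (h : ∀ i ∈ s, HighFreq m (C i) (f i)) : HighFreq m (∑ i ∈ s, C i) (∑ i ∈ s, f i) := by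
  classical
  induction s using Finset.induction_on with
  | empty => simpa using zero
  | insert a s ha ih =>
    rw [Finset.sum_insert ha, Finset.sum_insert ha]
    exact (h a (Finset.mem_insert_self a s)).add
      (ih fun i hi => h i (Finset.mem_insert_of_mem hi))

theorem cos_int {x : ℤ} (hx : (m : ℤ) ≤ |x|) : HighFreq m 1 fun θ => Real.cos (x * θ) := by
  have h : (fun θ : ℝ => Real.cos (x * θ)) = fun θ => Real.cos ((x.natAbs : ℕ) * θ) := by
    funext θ
    rw [Nat.cast_natAbs, Int.cast_abs]
    rcases abs_choice (x : ℝ) with h | h <;> rw [h]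
    rw [neg_mul, Real.cos_neg]
  rw [h]
  exact HighFreq.cos _ (by rw [Int.abs_eq_natAbs] at hx; exact_mod_cast hx)

theorem cos_mul_cos {x y : ℤ} (h : (m : ℤ) + |y| ≤ |x|) :
    HighFreq m 1 fun θ => Real.cos (x * θ) * Real.cos (y * θ) := by
  have h1 : (m : ℤ) ≤ |x + y| := by
    have := abs_add_le (x + y) (-y)
    rw [abs_neg, add_neg_cancel_right] at this
    linarith
  have h2 : (m : ℤ) ≤ |x - y| := by
    have := abs_add_le (x - y) y
    rw [sub_add_cancel] at this
    linarith
  have h3 := ((cos_int h1).add (cos_int h2)).smul (1 / 2)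
  convert h3 using 1
  · norm_num [abs_of_pos]
  · funext θ
    simp only [Pi.smul_apply, Pi.add_apply, smul_eq_mul]
    push_cast
    rw [add_mul, sub_mul, Real.cos_add, Real.cos_sub]
    ring

theorem abs_fejerFunctional_le {C : ℝ} {f : ℝ → ℝ} (hf : HighFreq m C f) {b : ℕ → ℝ} {ε : ℝ}
    (hb : ∀ n, m ≤ n → |b n| ≤ ε) :
    ∃ N₀, ∀ N, N₀ ≤ N → |fejerFunctional b N f| ≤ C * ε := by
  have hε : 0 ≤ ε := (abs_nonneg _).trans (hb m le_rfl)
  induction hf with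
  | cos n hn =>
    refine ⟨n + 1, fun N hN => ?_⟩
    have hnN : (n : ℝ) < N := by exact_mod_cast hN
    have hN0 : (0 : ℝ) < N := (Nat.cast_nonneg n).trans_lt hnN
    rw [fejerFunctional_cos b hN, abs_mul, abs_of_nonneg (div_nonneg (by linarith) hN0.le)]
    refine mul_le_mul ?_ (hb n hn) (abs_nonneg _) zero_le_one
    rw [div_le_one hN0]
    have := Nat.cast_nonneg (α := ℝ) n
    linarith
  | add _ _ hf hg =>
    obtain ⟨N₁, h₁⟩ := hf
    obtain ⟨N₂, h₂⟩ := hg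
    refine ⟨max N₁ N₂, fun N hN => ?_⟩
    rw [map_add, add_mul]
    exact (abs_add_le _ _).trans (add_le_add (h₁ N (le_of_max_le_left hN))
      (h₂ N (le_of_max_le_right hN)))
  | smul c _ hf =>
    obtain ⟨N₁, h₁⟩ := hf
    refine ⟨N₁, fun N hN => ?_⟩
    rw [map_smul, smul_eq_mul, abs_mul, mul_assoc]
    exact mul_le_mul_of_nonneg_left (h₁ N hN) (abs_nonneg c)
  | mono _ h hf =>
    obtain ⟨N₁, h₁⟩ := hf
    exact ⟨N₁, fun N hN => (h₁ N hN).trans (mul_le_mul_of_nonneg_right h hε)⟩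

end HighFreq

/-- Testing a positive definite sequence against a nonnegative trigonometric polynomial
`A - cos θ + T θ` with `T` of high frequency. -/
theorem IsPosDefSeq.le_of_nonneg {b : ℕ → ℝ} (hb : IsPosDefSeq b) (hb0 : b 0 = 1) {m : ℕ}
    {ε A C : ℝ} (hε : ∀ n, m ≤ n → |b n| ≤ ε) {T : ℝ → ℝ} (hT : HighFreq m C T)
    (hp : ∀ θ, 0 ≤ A - Real.cos θ + T θ) : b 1 ≤ A + C * ε := by
  obtain ⟨N₀, hN₀⟩ := hT.abs_fejerFunctional_le hε
  -- The Fejér weight `(N - 1) / N` on `b 1` disappears in the limit.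
  have hlim : Filter.Tendsto (fun N : ℕ => ((N : ℝ) - (1 : ℕ)) / N * b 1) Filter.atTop
      (nhds (b 1)) := by
    have h : Filter.Tendsto (fun N : ℕ => (1 - 1 / (N : ℝ)) * b 1) Filter.atTop
        (nhds ((1 - 0) * b 1)) :=
      (tendsto_const_nhds.sub tendsto_one_div_atTop_nhds_zero_nat).mul_const _
    rw [sub_zero, one_mul] at h
    refine h.congr' ?_
    filter_upwards [Filter.eventually_gt_atTop 0] with N hN
    have : (N : ℝ) ≠ 0 := by positivity
    field_simp
    rw [Nat.cast_one, mul_comm]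
  refine le_of_tendsto hlim ?_
  filter_upwards [Filter.eventually_ge_atTop N₀, Filter.eventually_gt_atTop 1] with N h1 h2
  have hsplit : (fun θ => A - Real.cos θ + T θ) = A • (fun θ : ℝ => Real.cos ((0 : ℕ) * θ))
      - (fun θ : ℝ => Real.cos ((1 : ℕ) * θ)) + T := by
    funext θ
    simp
  have h := fejerFunctional_nonneg hb N hp
  rw [hsplit, map_add, map_sub, map_smul, fejerFunctional_cos b h2,
    fejerFunctional_cos b (by omega : 0 < N), hb0] at h
  have hN : (N : ℝ) ≠ 0 := by have : 0 < N := by omega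
                              positivity
  have hT' := (abs_le.1 (hN₀ N h1)).2
  rw [Nat.cast_zero, sub_zero, div_self hN, smul_eq_mul] at h
  linarith

/-! ### Fejér kernel estimates -/

/-- The Dirichlet kernel square `|∑_{j<n} e^{ijt}|²`. -/
noncomputable def dirichletSq (n : ℕ) (t : ℝ) : ℝ :=
  ∑ j ∈ Finset.range n, ∑ k ∈ Finset.range n, Real.cos (((j : ℤ) - k : ℤ) * t)

theorem dirichletSq_eq (n : ℕ) (t : ℝ) : dirichletSq n t =
    (∑ j ∈ Finset.range n, Real.cos (j * t)) ^ 2 + (∑ j ∈ Finset.range n, Real.sin (j * t)) ^ 2 := by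
  rw [dirichletSq, sq, sq, Finset.sum_mul_sum, Finset.sum_mul_sum]
  simp_rw [← Finset.sum_add_distrib]
  refine Finset.sum_congr rfl fun j _ => Finset.sum_congr rfl fun k _ => ?_
  push_cast
  rw [sub_mul, Real.cos_sub]

theorem dirichletSq_nonneg (n : ℕ) (t : ℝ) : 0 ≤ dirichletSq n t := by
  rw [dirichletSq_eq]
  positivity

theorem dirichletSq_le (n : ℕ) (t : ℝ) : dirichletSq n t ≤ n ^ 2 := by
  have h : dirichletSq n t ≤ ∑ j ∈ Finset.range n, ∑ k ∈ Finset.range n, (1 : ℝ) :=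
    Finset.sum_le_sum fun j _ => Finset.sum_le_sum fun k _ => Real.cos_le_one _
  simpa [sq] using h

theorem le_dirichletSq (n : ℕ) (t : ℝ) :
    (n : ℝ) ^ 2 * (1 - (n * t) ^ 2 / 2) ≤ dirichletSq n t := by
  have h : ∑ j ∈ Finset.range n, ∑ k ∈ Finset.range n, (1 - (n * t) ^ 2 / 2)
      ≤ dirichletSq n t := by
    refine Finset.sum_le_sum fun j hj => Finset.sum_le_sum fun k hk => ?_
    refine le_trans ?_ (Real.one_sub_sq_div_two_le_cos (x := (((j : ℤ) - k : ℤ) : ℝ) * t))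
    have hj' : (j : ℝ) < n := by exact_mod_cast Finset.mem_range.1 hj
    have hk' : (k : ℝ) < n := by exact_mod_cast Finset.mem_range.1 hk
    have hsq : ((((j : ℤ) - k : ℤ) : ℝ)) ^ 2 ≤ (n : ℝ) ^ 2 := by
      push_cast
      have := Nat.cast_nonneg (α := ℝ) j
      have := Nat.cast_nonneg (α := ℝ) k
      exact sq_le_sq' (by linarith) (by linarith)
    rw [mul_pow, mul_pow]
    have := mul_le_mul_of_nonneg_right hsq (sq_nonneg t)
    linarith
  refine le_trans (le_of_eq ?_) h
  simp only [Finset.sum_const, Finset.card_range, nsmul_eq_mul]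
  ring

theorem dirichletSq_mul_one_sub_cos (n : ℕ) (t : ℝ) :
    dirichletSq n t * (1 - Real.cos t) = 1 - Real.cos (n * t) := by
  -- Real and imaginary parts of `(∑ e^{ijt}) (1 - e^{it}) = 1 - e^{int}`; the lemma follows by
  -- taking squared moduli.
  have hp : ∀ n : ℕ, (∑ j ∈ Finset.range n, Real.cos (j * t)) * (1 - Real.cos t)
      + (∑ j ∈ Finset.range n, Real.sin (j * t)) * Real.sin t = 1 - Real.cos (n * t) ∧
      (∑ j ∈ Finset.range n, Real.sin (j * t)) * (1 - Real.cos t)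
      - (∑ j ∈ Finset.range n, Real.cos (j * t)) * Real.sin t = - Real.sin (n * t) := by
    intro n
    induction n with
    | zero => simp
    | succ n ih =>
      obtain ⟨h1, h2⟩ := ih
      rw [Finset.sum_range_succ, Finset.sum_range_succ,
        show ((n + 1 : ℕ) : ℝ) * t = n * t + t by push_cast; ring, Real.cos_add, Real.sin_add]
      constructor
      · linear_combination h1
      · linear_combination h2
  obtain ⟨h1, h2⟩ := hp n
  rw [dirichletSq_eq]
  set P := ∑ j ∈ Finset.range n, Real.cos (j * t)
  set Q := ∑ j ∈ Finset.range n, Real.sin (j * t)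
  have e1 := congrArg (· ^ 2) h1
  have e2 := congrArg (· ^ 2) h2
  have c1 := Real.sin_sq_add_cos_sq t
  have c2 := Real.sin_sq_add_cos_sq (n * t)
  linear_combination (e1 + e2 + c2) / 2 - (P ^ 2 + Q ^ 2) / 2 * c1

theorem dirichletSq_add_int_mul_two_pi (n : ℕ) (t : ℝ) (z : ℤ) :
    dirichletSq n (t + z * (2 * Real.pi)) = dirichletSq n t := by
  refine Finset.sum_congr rfl fun j _ => Finset.sum_congr rfl fun k _ => ?_
  rw [mul_add, ← mul_assoc, ← Int.cast_mul, Real.cos_add_int_mul_two_pi]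

/-! ### The corrected test polynomial -/

/-- The high-frequency correction turning `A - cos θ` (almost) into a nonnegative function. -/
noncomputable def fejerCorrection (A : ℝ) (K l M : ℕ) (θ : ℝ) : ℝ :=
  (dirichletSq K (M * θ - Real.pi) / K - 1) * ((A - Real.cos θ) * (dirichletSq l θ / l ^ 2))

/-- The factor `1 - ψ + k ψ` is nonnegative, which settles `cos θ ≤ cos a`. For `|θ| < a` modulo
`2π`, `M θ - π` stays `δ` away from `2πℤ`, so `k ≤ η` and the factor is at most `η + (l a)² / 2`;
the added constant pays for this. -/
theorem fejerCorrection_nonneg {a δ η : ℝ} {K l M : ℕ} (hK : 0 < K) (hl : 0 < l) (ha : 0 ≤ a)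
    (hδ : 0 < δ) (haM : a * M = Real.pi - δ) (hη : 2 ≤ η * (K * (1 - Real.cos δ))) (θ : ℝ) :
    0 ≤ Real.cos a + (1 - Real.cos a) * (η + (l * a) ^ 2 / 2) - Real.cos θ
      + fejerCorrection (Real.cos a) K l M θ := by
  have hK' : (0 : ℝ) < K := by exact_mod_cast hK
  have hl' : (0 : ℝ) < l := by exact_mod_cast hl
  have hcδ : 0 ≤ 1 - Real.cos δ := by linarith [Real.cos_le_one δ]
  have hη0 : 0 ≤ η := by
    by_contra! h
    have := mul_nonneg hK'.le hcδ
    nlinarith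
  have hA : 0 ≤ 1 - Real.cos a := by linarith [Real.cos_le_one a]
  have hE : 0 ≤ η + (l * a) ^ 2 / 2 := by positivity
  obtain ⟨z, t, ht, rfl⟩ : ∃ (z : ℤ) (t : ℝ), |t| ≤ Real.pi ∧ θ = t + z * (2 * Real.pi) := by
    have hmem := toIocMod_mem_Ioc Real.two_pi_pos (-Real.pi) θ
    refine ⟨toIocDiv Real.two_pi_pos (-Real.pi) θ, toIocMod Real.two_pi_pos (-Real.pi) θ,
      abs_le.2 ⟨hmem.1.le, by linarith [hmem.2]⟩, ?_⟩
    have := toIocMod_add_toIocDiv_zsmul Real.two_pi_pos (-Real.pi) θ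
    rw [zsmul_eq_mul] at this
    exact this.symm
  rw [fejerCorrection, dirichletSq_add_int_mul_two_pi, Real.cos_add_int_mul_two_pi,
    show (M : ℝ) * (t + z * (2 * Real.pi)) - Real.pi
      = (M * t - Real.pi) + ((M * z : ℤ) : ℝ) * (2 * Real.pi) by push_cast; ring,
    dirichletSq_add_int_mul_two_pi]
  have hψ0 : 0 ≤ dirichletSq l t / l ^ 2 := div_nonneg (dirichletSq_nonneg _ _) (by positivity)
  have hψ1 : dirichletSq l t / l ^ 2 ≤ 1 := (div_le_one (by positivity)).2 (dirichletSq_le _ _)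
  have hψ2 : 1 - (l * t) ^ 2 / 2 ≤ dirichletSq l t / l ^ 2 := by
    rw [le_div_iff₀ (by positivity), mul_comm]
    exact le_dirichletSq _ _
  have hk0 : 0 ≤ dirichletSq K (M * t - Real.pi) / K :=
    div_nonneg (dirichletSq_nonneg _ _) hK'.le
  have hk1 := dirichletSq_mul_one_sub_cos K (M * t - Real.pi)
  have hkK : dirichletSq K (M * t - Real.pi) = K * (dirichletSq K (M * t - Real.pi) / K) := by
    field_simp
  rw [hkK] at hk1
  set ψ := dirichletSq l t / l ^ 2
  set k := dirichletSq K (M * t - Real.pi) / K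
  have hEA := mul_nonneg hA hE
  rcases le_or_gt (Real.cos t) (Real.cos a) with h | h
  · have h1 := mul_nonneg hk0 (mul_nonneg (sub_nonneg.2 h) hψ0)
    have h2 := mul_nonneg (sub_nonneg.2 h) (sub_nonneg.2 hψ1)
    linarith
  · have hta : |t| < a := by
      by_contra! h'
      have := Real.cos_le_cos_of_nonneg_of_le_pi ha ht h'
      rw [Real.cos_abs] at this
      linarith
    have hMt : |M * t| ≤ Real.pi - δ := by
      rw [abs_mul, Nat.abs_cast, ← haM, mul_comm]
      exact mul_le_mul_of_nonneg_right hta.le (Nat.cast_nonneg _)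
    have hcos : Real.cos (M * t - Real.pi) ≤ Real.cos δ := by
      have := Real.cos_le_cos_of_nonneg_of_le_pi (abs_nonneg _) (by linarith) hMt
      rw [Real.cos_abs, Real.cos_pi_sub] at this
      rw [Real.cos_sub_pi]
      linarith
    have hk2 : k ≤ η := by
      by_contra! hk
      have h3 : (K : ℝ) * k * (1 - Real.cos δ) ≤ K * k * (1 - Real.cos (M * t - Real.pi)) :=
        mul_le_mul_of_nonneg_left (by linarith) (by positivity)
      have h4 : (K : ℝ) * k * (1 - Real.cos (M * t - Real.pi)) ≤ 2 := by
        rw [hk1]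
        linarith [Real.neg_one_le_cos (K * (M * t - Real.pi))]
      have h5 : 0 < (K : ℝ) * (1 - Real.cos δ) := by
        refine lt_of_le_of_ne (by positivity) fun h0 => ?_
        rw [← h0] at hη
        linarith
      have := mul_lt_mul_of_pos_right hk h5
      linarith
    have hψ3 : 1 - (l * a) ^ 2 / 2 ≤ ψ := by
      have h6 : t ^ 2 ≤ a ^ 2 := by
        rw [← sq_abs t]
        gcongr
      have : (l * t) ^ 2 ≤ (l * a) ^ 2 := by
        rw [mul_pow, mul_pow]
        gcongr
      linarith
    have hd : 0 ≤ Real.cos t - Real.cos a := by linarith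
    have h7 := mul_nonneg hd (sub_nonneg.2 hψ3)
    have h8 : (Real.cos t - Real.cos a) * (k * ψ) ≤ (Real.cos t - Real.cos a) * η := by
      refine mul_le_mul_of_nonneg_left ?_ hd
      calc k * ψ ≤ k * 1 := mul_le_mul_of_nonneg_left hψ1 hk0
        _ ≤ η := by linarith
    have h9 := mul_nonneg (by linarith [Real.cos_le_one t] : 0 ≤ 1 - Real.cos t) hE
    linarith

/-- Write `A - cos θ = (A - 1) + (1 - cos θ)`: the kernel identity collapses the second part to `(1
- cos (l θ)) / l²`. This keeps the coefficient sum of order `1 / m²`. -/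
theorem HighFreq.cos_mul_fejer {m l : ℕ} (hl : 0 < l) {x : ℤ} (hx : (m : ℤ) + l ≤ |x|) {A : ℝ}
    (hA : A ≤ 1) : HighFreq m ((1 - A) + 2 / l ^ 2)
      fun θ => Real.cos (x * θ) * ((A - Real.cos θ) * (dirichletSq l θ / l ^ 2)) := by
  have hl' : (0 : ℝ) < l := by exact_mod_cast hl
  have h1 : HighFreq m (∑ j ∈ Finset.range l, ∑ k ∈ Finset.range l, 1)
      (∑ j ∈ Finset.range l, ∑ k ∈ Finset.range l,
        fun θ => Real.cos (x * θ) * Real.cos (((j : ℤ) - k : ℤ) * θ)) := by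
    refine HighFreq.sum _ _ _ fun j hj => HighFreq.sum _ _ _ fun k hk => cos_mul_cos ?_
    rw [Finset.mem_range] at hj hk
    have : |(j : ℤ) - k| ≤ l := by rw [abs_le]; constructor <;> omega
    linarith
  have h2 : HighFreq m 1 fun θ => Real.cos (x * θ) * Real.cos ((0 : ℤ) * θ) :=
    cos_mul_cos (by rw [abs_zero]; linarith [Int.natCast_nonneg l])
  have h3 : HighFreq m 1 fun θ => Real.cos (x * θ) * Real.cos ((l : ℤ) * θ) :=
    cos_mul_cos (by rwa [Nat.abs_cast])
  have h := ((h1.smul ((A - 1) / l ^ 2)).add (h2.smul (1 / l ^ 2))).add (h3.smul (-(1 / l ^ 2)))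
  convert h using 1
  · rw [abs_neg, abs_div, abs_of_nonpos (by linarith : A - 1 ≤ 0),
      abs_of_pos (by positivity : (0 : ℝ) < l ^ 2), abs_of_pos (by positivity)]
    simp only [Finset.sum_const, Finset.card_range, nsmul_eq_mul]
    field_simp
    ring
  · funext θ
    have hs : (∑ j ∈ Finset.range l, ∑ k ∈ Finset.range l,
        fun θ => Real.cos (x * θ) * Real.cos (((j : ℤ) - k : ℤ) * θ)) θ
        = Real.cos (x * θ) * dirichletSq l θ := by
      simp only [Finset.sum_apply, dirichletSq, Finset.mul_sum]
    simp only [Pi.add_apply, Pi.smul_apply, smul_eq_mul, hs]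
    have hD := dirichletSq_mul_one_sub_cos l θ
    rw [Int.cast_zero, zero_mul, Real.cos_zero, Int.cast_natCast]
    generalize Real.cos ((l : ℝ) * θ) = c at hD ⊢
    field_simp
    linear_combination Real.cos (x * θ) * hD

theorem highFreq_fejerCorrection {m l K M : ℕ} (hl : 0 < l) (hK : 0 < K) (hM : m + l ≤ M)
    {A : ℝ} (hA : A ≤ 1) :
    HighFreq m (K * ((1 - A) + 2 / l ^ 2)) (fejerCorrection A K l M) := by
  have hK' : (0 : ℝ) < K := by exact_mod_cast hK
  set B := (1 - A) + 2 / (l : ℝ) ^ 2 with hB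
  have hB0 : 0 ≤ B := by
    have : (0 : ℝ) ≤ 2 / (l : ℝ) ^ 2 := by positivity
    linarith
  set g : ℝ → ℝ := fun θ => (A - Real.cos θ) * (dirichletSq l θ / l ^ 2) with hg
  have h := HighFreq.sum (m := m) (Finset.range K) (fun _ => ∑ q ∈ Finset.range K, B / K)
    (fun p => ∑ q ∈ Finset.range K,
      (if p = q then 0 else Real.cos (((p : ℤ) - q : ℤ) * Real.pi) / K) •
        fun θ => Real.cos ((((p : ℤ) - q) * M : ℤ) * θ) * g θ) ?_
  · convert h using 1
    · simp only [Finset.sum_const, Finset.card_range, nsmul_eq_mul]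
      field_simp
    · funext θ
      -- The diagonal of the Fejér kernel is the constant `1` being subtracted; off it, all
      -- frequencies are nonzero multiples of `M`.
      have hone : (1 : ℝ) = ∑ p ∈ Finset.range K, ∑ q ∈ Finset.range K,
          (if p = q then 1 / (K : ℝ) else 0) := by
        rw [Finset.sum_congr rfl fun p hp => by rw [Finset.sum_ite_eq, if_pos hp]]
        rw [Finset.sum_const, Finset.card_range, nsmul_eq_mul]
        field_simp
      simp only [Finset.sum_apply, Pi.smul_apply, smul_eq_mul]
      rw [fejerCorrection, hone, dirichletSq, Finset.sum_div, ← Finset.sum_sub_distrib,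
        Finset.sum_mul]
      refine Finset.sum_congr rfl fun p _ => ?_
      rw [Finset.sum_div, ← Finset.sum_sub_distrib, Finset.sum_mul]
      refine Finset.sum_congr rfl fun q _ => ?_
      split_ifs with hpq
      · simp [hpq]
      · rw [mul_sub, Real.cos_sub, Real.sin_int_mul_pi, hg]
        push_cast
        ring_nf
  · intro p _
    refine HighFreq.sum _ _ _ fun q _ => ?_
    by_cases hpq : p = q
    · have h0 : HighFreq m 0 (0 : ℝ → ℝ) := HighFreq.zero
      simpa [hpq] using h0.mono (by positivity : 0 ≤ B / K)
    · rw [if_neg hpq]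
      have hx : (m : ℤ) + l ≤ |((p : ℤ) - q) * M| := by
        have h1 : 1 ≤ |(p : ℤ) - q| := Int.one_le_abs (by omega)
        rw [abs_mul, Nat.abs_cast]
        have h2 : (m : ℤ) + l ≤ M := by exact_mod_cast hM
        nlinarith
      refine ((HighFreq.cos_mul_fejer hl hx hA).smul _).mono ?_
      rw [← hB, abs_div, abs_of_pos hK', div_mul_eq_mul_div]
      gcongr
      exact mul_le_of_le_one_left hB0 (Real.abs_cos_le_one _)

/-! ### Choice of parameters -/

theorem IsPosDefSeq.exists_le_one_sub_div_sq {γ : ℝ} (hγ_lt : γ < Real.pi ^ 2 / 2) :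
    ∃ ε : ℝ, 0 < ε ∧ ∃ m₀ : ℕ, ∀ b : ℕ → ℝ, IsPosDefSeq b → b 0 = 1 → ∀ m : ℕ, m₀ ≤ m →
      (∀ n, m ≤ n → |b n| ≤ ε) → b 1 ≤ 1 - γ / (m : ℝ) ^ 2 := by
  -- `f δ / m²` is the guaranteed gain before the `ε` term; `f 0 = π² / 2` leaves room above `γ`.
  set f : ℝ → ℝ := fun δ => (Real.pi - δ) ^ 2 / (2 * (1 + 2 * δ) ^ 2) * (1 - δ) *
    (1 - δ - 2 * Real.pi ^ 2 * δ ^ 2) with hf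
  obtain ⟨δ, hδ0, hδ1, hδ2, hfδ⟩ : ∃ δ : ℝ, 0 < δ ∧ δ < 1 ∧
      0 < 1 - δ - 2 * Real.pi ^ 2 * δ ^ 2 ∧ γ < f δ := by
    have hfc : ContinuousAt f 0 := by
      have : (2 * (1 + 2 * (0 : ℝ)) ^ 2) ≠ 0 := by norm_num
      fun_prop (disch := assumption)
    have hf0 : γ < f 0 := by simpa [hf] using hγ_lt
    have h1 := hfc.eventually (lt_mem_nhds hf0)
    have hgc : ContinuousAt (fun δ : ℝ => 1 - δ - 2 * Real.pi ^ 2 * δ ^ 2) 0 := by fun_prop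
    have h2 := hgc.eventually (lt_mem_nhds (a := 0) (by norm_num))
    have h3 : ∀ᶠ δ : ℝ in nhds 0, δ < 1 := gt_mem_nhds one_pos
    have h4 := ((h1.and (h2.and h3)).filter_mono nhdsWithin_le_nhds).and
      (self_mem_nhdsWithin : Set.Ioi (0 : ℝ) ∈ nhdsWithin 0 (Set.Ioi 0))
    obtain ⟨δ, ⟨h1, h2, h3⟩, h4⟩ := h4.exists
    exact ⟨δ, h4, h3, h2, h1⟩
  have hπ3 := Real.pi_gt_three
  have hcδ : 0 < 1 - Real.cos δ := by
    have := Real.cos_lt_cos_of_nonneg_of_le_pi le_rfl (by linarith) hδ0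
    rw [Real.cos_zero] at this
    linarith
  obtain ⟨K, hK⟩ := exists_nat_gt (2 / (δ * (1 - Real.cos δ)))
  have hK0 : (0 : ℝ) < K := lt_trans (by positivity) hK
  rw [div_lt_iff₀ (by positivity)] at hK
  set C := (K : ℝ) * (Real.pi ^ 2 / 2 + 2 / δ ^ 2) with hC
  have hC0 : 0 < C := by positivity
  obtain ⟨m₀, hm₀⟩ := exists_nat_gt (Real.pi / δ)
  rw [div_lt_iff₀ hδ0] at hm₀
  -- The correction has coefficient sum at most `C / m²`, so this `ε` costs at most the slack `(f δ
  -- - γ) / m²`.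
  refine ⟨(f δ - γ) / C, div_pos (by linarith) hC0, m₀, fun b hb hb0 m hm hε => ?_⟩
  have hmδ : Real.pi < m * δ := by
    have : (m₀ : ℝ) ≤ m := by exact_mod_cast hm
    exact hm₀.trans_le (mul_le_mul_of_nonneg_right this hδ0.le)
  have hm0 : (0 : ℝ) < m := by
    by_contra! h
    have := mul_nonpos_of_nonpos_of_nonneg h hδ0.le
    linarith
  set l := ⌈(m : ℝ) * δ⌉₊ with hl
  have hl1 : (m : ℝ) * δ ≤ l := Nat.le_ceil _
  have hl2 : (l : ℝ) ≤ 2 * (m * δ) := by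
    have := Nat.ceil_lt_add_one (mul_nonneg hm0.le hδ0.le)
    linarith
  have hl0 : (0 : ℝ) < l := by linarith
  set M := m + l with hM
  have hMr : (M : ℝ) = m + l := by push_cast [hM]; rfl
  have hM0 : (0 : ℝ) < M := by linarith
  set a := (Real.pi - δ) / M with ha
  have haM : a * M = Real.pi - δ := by rw [ha]; field_simp
  have ha0 : 0 < a := div_pos (by linarith) hM0
  have ha1 : a ≤ Real.pi / m := by
    rw [ha]
    gcongr <;> linarith
  have ha2 : a ≤ δ := ha1.trans (by rw [div_le_iff₀ hm0]; linarith)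
  have ha3 : (Real.pi - δ) / ((1 + 2 * δ) * m) ≤ a := by
    rw [ha]
    have : 0 ≤ Real.pi - δ := by linarith
    gcongr
    linarith
  have hη : 2 ≤ δ * (K * (1 - Real.cos δ)) := by linarith
  have hmain := hb.le_of_nonneg hb0 hε
    (highFreq_fejerCorrection (m := m) (l := l) (K := K) (M := M) (by exact_mod_cast hl0)
      (by exact_mod_cast hK0) le_rfl (Real.cos_le_one a))
    (fejerCorrection_nonneg (by exact_mod_cast hK0) (by exact_mod_cast hl0) ha0.le hδ0 haM
      hη)
  have hA1 : 1 - Real.cos a ≤ a ^ 2 / 2 := by linarith [Real.one_sub_sq_div_two_le_cos (x := a)]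
  have hA2 : a ^ 2 / 2 * (1 - δ) ≤ 1 - Real.cos a := by
    have h1 := (abs_le.1 (Real.cos_bound (x := a) (by rw [abs_of_pos ha0]; linarith))).2
    rw [abs_of_pos ha0] at h1
    have h2 : a ^ 2 ≤ δ := by nlinarith
    have h3 := mul_le_mul_of_nonneg_left h2 (sq_nonneg a)
    have h4 := mul_nonneg (sq_nonneg a) (sq_nonneg a)
    linarith
  have hla : (l * a) ^ 2 / 2 ≤ 2 * Real.pi ^ 2 * δ ^ 2 := by
    have h1 : l * a ≤ 2 * (m * δ) * (Real.pi / m) := by gcongr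
    have h2 : 2 * (m * δ) * (Real.pi / m) = 2 * Real.pi * δ := by field_simp
    rw [h2] at h1
    have h3 : (l * a) ^ 2 ≤ (2 * Real.pi * δ) ^ 2 := by gcongr
    linarith
  have hCm : K * ((1 - Real.cos a) + 2 / (l : ℝ) ^ 2) * ((f δ - γ) / C)
      ≤ (f δ - γ) / (m : ℝ) ^ 2 := by
    have h1 : (1 - Real.cos a) + 2 / (l : ℝ) ^ 2
        ≤ (Real.pi ^ 2 / 2 + 2 / δ ^ 2) / (m : ℝ) ^ 2 := by
      have h2 : a ^ 2 ≤ (Real.pi / m) ^ 2 := by gcongr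
      have h3 : 2 / (l : ℝ) ^ 2 ≤ 2 / (m * δ) ^ 2 := by gcongr
      calc _ ≤ (Real.pi / m) ^ 2 / 2 + 2 / (m * δ) ^ 2 := by linarith
        _ = _ := by field_simp
    have h4 : 0 ≤ (f δ - γ) / C := div_nonneg (by linarith) hC0.le
    calc _ ≤ K * ((Real.pi ^ 2 / 2 + 2 / δ ^ 2) / (m : ℝ) ^ 2) * ((f δ - γ) / C) := by gcongr
      _ = C / (m : ℝ) ^ 2 * ((f δ - γ) / C) := by rw [hC]; ring
      _ = _ := by field_simp
  have hfa : f δ / (m : ℝ) ^ 2 ≤ (1 - Real.cos a) * (1 - δ - 2 * Real.pi ^ 2 * δ ^ 2) := by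
    have h0 : 0 ≤ (Real.pi - δ) / ((1 + 2 * δ) * m) := div_nonneg (by linarith) (by positivity)
    calc f δ / (m : ℝ) ^ 2 = ((Real.pi - δ) / ((1 + 2 * δ) * m)) ^ 2 / 2 * (1 - δ) *
          (1 - δ - 2 * Real.pi ^ 2 * δ ^ 2) := by
          rw [hf]
          field_simp
      _ ≤ a ^ 2 / 2 * (1 - δ) * (1 - δ - 2 * Real.pi ^ 2 * δ ^ 2) := by
          have : 0 ≤ 1 - δ := by linarith
          gcongr
      _ ≤ _ := mul_le_mul_of_nonneg_right hA2 hδ2.le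
  have hlast : (1 - Real.cos a) * (δ + (l * a) ^ 2 / 2)
      ≤ (1 - Real.cos a) * (δ + 2 * Real.pi ^ 2 * δ ^ 2) :=
    mul_le_mul_of_nonneg_left (by linarith) (by linarith [Real.cos_le_one a])
  rw [sub_div (f δ) γ ((m : ℝ) ^ 2)] at hCm
  linarith

/-! ### From positive definite sequences to operators -/

theorem mainTheorem4 (γ : ℝ) (hγ_pos : 0 < γ) (hγ_lt : γ < Real.pi ^ 2 / 2) :
    ∃ ε : ℝ, 0 < ε ∧ ∃ m₀ : ℕ,
      ∀ (𝕜 : Type*) (H : Type*) [RCLike 𝕜] [NormedAddCommGroup H] [InnerProductSpace 𝕜 H]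
        [CompleteSpace H] (S : H →L[𝕜] H), ‖S‖ ≤ 1 →
        ∀ m : ℕ, m₀ ≤ m → ‖S ^ m‖ ≤ ε →
          numericalRadius S ≤ 1 - γ / (m : ℝ) ^ 2 := by
  obtain ⟨ε, hε, m₁, hmain⟩ := IsPosDefSeq.exists_le_one_sub_div_sq hγ_lt
  obtain ⟨m₂, hm₂⟩ := exists_nat_gt γ
  refine ⟨ε, hε, max m₁ (max m₂ 1), fun 𝕜 H _ _ _ _ S hS m hm hSm => ?_⟩
  -- Needed for a vanishing inner product and for the zero space, where the supremum is empty.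
  have hnonneg : 0 ≤ 1 - γ / (m : ℝ) ^ 2 := by
    have h1 : (1 : ℝ) ≤ m := by
      exact_mod_cast ((le_max_right _ _).trans (le_max_right _ _)).trans hm
    have h2 : (m₂ : ℝ) ≤ m := by
      exact_mod_cast ((le_max_left _ _).trans (le_max_right _ _)).trans hm
    rw [sub_nonneg, div_le_one (by positivity)]
    nlinarith
  refine Real.iSup_le (fun u => ?_) hnonneg
  obtain ⟨u, hu⟩ := u
  change ‖inner 𝕜 (S u) u‖ ≤ _
  by_cases hz : inner 𝕜 (S u) u = 0
  · rwa [hz, norm_zero]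
  set z : 𝕜 := inner 𝕜 (S u) u with hz_def
  have hz0 : (‖z‖ : 𝕜) ≠ 0 := by simpa using hz
  -- The inner product is conjugate-linear in its first slot, so `c`, not its conjugate, turns `z`
  -- into `‖z‖`.
  set c : 𝕜 := z / (‖z‖ : 𝕜) with hc
  have hc1 : ‖c‖ = 1 := by
    rw [hc, norm_div, RCLike.norm_ofReal, abs_norm, div_self (norm_ne_zero_iff.2 hz)]
  have hcS : ‖c • S‖ ≤ 1 := by rwa [norm_smul, hc1, one_mul]
  have hinner : RCLike.re (inner 𝕜 (((c • S) ^ 1) u) u) = ‖z‖ := by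
    rw [pow_one, smul_apply, inner_smul_left, ← hz_def, hc, map_div₀,
      RCLike.conj_ofReal, div_mul_eq_mul_div, RCLike.conj_mul, sq, mul_div_assoc,
      div_self hz0, mul_one, RCLike.ofReal_re]
  rw [← hinner]
  refine hmain (fun n => RCLike.re (inner 𝕜 (((c • S) ^ n) u) u))
    (isPosDefSeq_re_inner_pow (c • S) hcS u) ?_ m ((le_max_left _ _).trans hm) fun n hn => ?_
  · simp [hu]
  · have h1 : ‖(c • S) ^ n‖ ≤ ε := by
      rw [smul_pow, norm_smul, norm_pow, hc1, one_pow, one_mul, ← Nat.sub_add_cancel hn, pow_add]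
      refine (norm_mul_le _ _).trans ?_
      have h2 : ‖S ^ (n - m)‖ ≤ 1 := by
        rcases Nat.eq_zero_or_pos (n - m) with h0 | h0
        · rw [h0, pow_zero]
          exact ContinuousLinearMap.norm_id_le
        · exact (norm_pow_le' S h0).trans (pow_le_one₀ (norm_nonneg _) hS)
      calc ‖S ^ (n - m)‖ * ‖S ^ m‖ ≤ 1 * ε := by gcongr
        _ = ε := one_mul ε
    have h3 := ((c • S) ^ n).le_of_opNorm_le h1 u
    calc |RCLike.re (inner 𝕜 (((c • S) ^ n) u) u)| ≤ ‖inner 𝕜 (((c • S) ^ n) u) u‖ :=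
          RCLike.abs_re_le_norm _
      _ ≤ ‖((c • S) ^ n) u‖ * ‖u‖ := norm_inner_le_norm _ _
      _ ≤ ε := by rw [hu] at h3 ⊢; linarith
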